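/- Let $\tau=\frac{1+\sqrt5}{2}$, $\tau'=\frac{1-\sqrt5}{2}$, $\mathcal L=\{(m+n\tau,\,m+n\tau'):m,n\in\mathbb Z\}\subseteq\mathbb R^2$, and let $\mathbf{Fib}=\{x : (x,y)\in\mathcal L \text{ for some } y\in[-1,\tau-1)\}$ be the Fibonacci model set. Let $\mathcal L^0=\{y\in\mathbb R^2: e^{2\pi i x\cdot y}=1 \text{ for all } x\in\mathcal L\}=\left\{\left(\frac{n-m\tau'}{\sqrt5},\frac{m\tau-n}{\sqrt5}\right):m,n\in\mathbb Z\right\}$ be the dual lattice. For $k$ in its first projection let $k^\star$ be the unique real number with $(k,k^\star)\in\mathcal L^0$, and for $J\subseteq\mathbb R$ put $\curlywedge^\star(J)=\{k : (k,k^\star)\in\mathcal L^0,\ k^\star\in J\}$. Let $\Lambda\subseteq\mathbf{Fib}$ be any subset and let $\mathcal A=(A_n)_n$ be a van Hove sequence of compact subsets of $\mathbb R$ (that is, $|A_n|>0$ and $|\partial^K(A_n)|/|A_n|\to0$ for every non-empty compact $K\subseteq\mathbb R$, where $\partial^K(B)=((K+B)\setminus B^\circ)\cup((-K+\overline{\mathbb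 R\setminus B})\cap B)$) along which the autocorrelation of $\Lambda$ exists, that is, the limit $$\eta(z)=\lim_{n}\frac{1}{|A_n|}\,\#\{(x,y)\in(\Lambda\cap A_n)^2 : x-y=z\}$$ exists for every $z\in\Lambda-\Lambda$. Let $\gamma_\Lambda=\sum_{z\in\Lambda-\Lambda}\eta(z)\delta_z$ be the autocorrelation, and let the diffraction measure $\widehat{\gamma_\Lambda}$ be its Fourier transform, that is, the positive Radon measure on $\mathbb R$ such that for all $\varphi\in C_c(\mathbb R)$ one has $\check\varphi\in L^2(\widehat{\gamma_\Lambda})$ and $\gamma_\Lambda(\varphi*\tilde\varphi)=\widehat{\gamma_\Lambda}(|\check\varphi|^2)$, where $\check\varphi(k)=\int_{\mathbb R} e^{2\pi i kx}\varphi(x)\,dx$ and $\tilde\varphi(x)=\overline{\varphi(-x)}$. One says that $\Lambda$ has a Bragg peak at $k$, of intensity $\widehat{\gamma_\Lambda}(\{k\})$, if $\widehat{\gamma_\Lambda}(\{k\})>0$. If $I:=\widehat{\gamma_\Lambda}(\{0\})>0$, then $\Lambda$ has a Bragg peak at every $k\in\curlywedge^\star\left(\left(-\frac{1}{2\pi\tau},\frac{1}{2\pi\tau}\right)\right)$,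 and its intensity satisfies $$\widehat{\gamma_\Lambda}(\{k\})\ \ge\ (1-2\pi|k^\star|\tau)\,I\ >\ 0 .$$ -/

import Mathlib

open Filter MeasureTheory Topology
open scoped Pointwise FourierTransform Convolution

noncomputable section

namespace FibDiffraction

/-! ### Cut-and-project sets in `ℝ × ℝ` -/

/-- For a lattice `L ⊆ ℝ × ℝ` and a window `W ⊆ ℝ`, the set `π₁ (L ∩ (ℝ × W))`. -/
def modelSet (L : Set (ℝ × ℝ)) (W : Set ℝ) : Set ℝ :=
  {x | ∃ y ∈ W, (x, y) ∈ L}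

/-- The star map of `L`: for `x ∈ π₁ L` the element `x⋆` with `(x, x⋆) ∈ L`. It is unique when
`π₁` is injective on `L`; outside `π₁ L` the value is arbitrary and is never used. -/
def starMap (L : Set (ℝ × ℝ)) (x : ℝ) : ℝ :=
  Classical.epsilon fun y => (x, y) ∈ L

/-- The lattice `{(m + n τ, m + n τ') : m, n ∈ ℤ}`, with `τ = (1 + √5) / 2` and
`τ' = (1 - √5) / 2`. -/
def fibLattice : Set (ℝ × ℝ) :=
  {p | ∃ m n : ℤ, p = ((m : ℝ) + n * Real.goldenRatio, (m : ℝ) + n * Real.goldenConj)}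

/-- The dual lattice (annihilator) `{y ∈ ℝ² : exp (2 π i x · y) = 1 for all x ∈ L}`. -/
def dualLattice (L : Set (ℝ × ℝ)) : Set (ℝ × ℝ) :=
  {y | ∀ x ∈ L,
    Complex.exp (2 * Real.pi * Complex.I * ((x.1 * y.1 + x.2 * y.2 : ℝ) : ℂ)) = 1}

/-- The Fibonacci model set: all `x ∈ ℤ[τ]` with `x⋆ ∈ [-1, τ - 1)`. -/
def Fib : Set ℝ :=
  modelSet fibLattice (Set.Ico (-1) (Real.goldenRatio - 1))

/-- The model sets of the dual lattice of `fibLattice`. -/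
def dualModelSet (J : Set ℝ) : Set ℝ :=
  modelSet (dualLattice fibLattice) J

/-- The star map of the dual lattice of `fibLattice`. -/
def dualStar : ℝ → ℝ :=
  starMap (dualLattice fibLattice)

lemma mem_dualLattice_fib_iff (p : ℝ × ℝ) :
    p ∈ dualLattice fibLattice ↔
      ∃ m n : ℤ, p = ((n - m * Real.goldenConj) / √5, (m * Real.goldenRatio - n) / √5) := by
  have h5 : (√5 : ℝ) ≠ 0 := by positivity
  have hs : (√5 : ℝ) * √5 = 5 := Real.mul_self_sqrt (by norm_num)
  have hpi : (2 * Real.pi * Complex.I : ℂ) ≠ 0 := Complex.two_pi_I_ne_zero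
  have key : ∀ r : ℝ, Complex.exp (2 * Real.pi * Complex.I * (r : ℂ)) = 1 ↔
      ∃ n : ℤ, r = n := by
    intro r
    rw [Complex.exp_eq_one_iff]
    refine exists_congr fun n => ?_
    rw [mul_comm (n : ℂ), mul_right_inj' hpi]
    exact_mod_cast Iff.rfl
  constructor
  · intro hp
    obtain ⟨a, ha⟩ := (key _).1 (hp (1, 1) ⟨1, 0, by simp⟩)
    obtain ⟨b, hb⟩ := (key _).1 (hp (Real.goldenRatio, Real.goldenConj) ⟨0, 1, by simp⟩)
    refine ⟨a, b, Prod.ext ?_ ?_⟩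
    · simp only [Real.goldenRatio, Real.goldenConj] at *
      rw [eq_div_iff h5, ← ha, ← hb]
      ring
    · simp only [Real.goldenRatio, Real.goldenConj] at *
      rw [eq_div_iff h5, ← ha, ← hb]
      ring
  · rintro ⟨m, n, rfl⟩ _ ⟨a, b, rfl⟩
    refine (key _).2 ⟨a * m + b * n, ?_⟩
    push_cast
    simp only [Real.goldenRatio, Real.goldenConj]
    field_simp
    ring

lemma mem_dualModelSet_iff (J : Set ℝ) (k : ℝ) :
    k ∈ dualModelSet J ↔
      ∃ m n : ℤ, k = (n - m * Real.goldenConj) / √5 ∧ (m * Real.goldenRatio - n) / √5 ∈ J := by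
  constructor
  · rintro ⟨y, hy, h⟩
    obtain ⟨m, n, hp⟩ := (mem_dualLattice_fib_iff _).1 h
    rw [Prod.mk.injEq] at hp
    exact ⟨m, n, hp.1, hp.2 ▸ hy⟩
  · rintro ⟨m, n, rfl, h⟩
    exact ⟨_, h, (mem_dualLattice_fib_iff _).2 ⟨m, n, rfl⟩⟩

lemma dualStar_eq (m n : ℤ) :
    dualStar ((n - m * Real.goldenConj) / √5) = (m * Real.goldenRatio - n) / √5 := by
  have h5 : (√5 : ℝ) ≠ 0 := by positivity
  have h : ((n - m * Real.goldenConj) / √5, dualStar ((n - m * Real.goldenConj) / √5)) ∈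
      dualLattice fibLattice :=
    Classical.epsilon_spec (p := fun y => ((n - m * Real.goldenConj) / √5, y) ∈
      dualLattice fibLattice) ⟨_, (mem_dualLattice_fib_iff _).2 ⟨m, n, rfl⟩⟩
  obtain ⟨a, b, hp⟩ := (mem_dualLattice_fib_iff _).1 h
  rw [Prod.mk.injEq] at hp
  obtain ⟨h1, h2⟩ := hp
  rw [div_left_inj' h5] at h1
  have ham : a = m := by
    by_contra hne
    have hne' : ((a - m : ℤ) : ℝ) ≠ 0 := by exact_mod_cast sub_ne_zero.2 hne
    refine Real.goldenConj_irrational ⟨((b - n : ℤ) : ℚ) / ((a - m : ℤ) : ℚ), ?_⟩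
    push_cast at hne' ⊢
    rw [div_eq_iff hne']
    linarith
  subst ham
  have hbn : (b : ℝ) = n := by linarith
  rw [h2, hbn]

/-! ### Autocorrelation and diffraction -/

/-- The `K`-boundary of a set `B ⊆ ℝ`. -/
def kBoundary (K B : Set ℝ) : Set ℝ :=
  ((K + B) \ interior B) ∪ ((-K + closure Bᶜ) ∩ B)

/-- Van Hove sequences of compact subsets of `ℝ` (of positive measure, so that the quotients
make sense). -/
structure IsVanHove (A : ℕ → Set ℝ) : Prop where
  isCompact : ∀ n, IsCompact (A n)
  volume_pos : ∀ n, 0 < volume (A n)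
  tendsto_boundary : ∀ K : Set ℝ, IsCompact K → K.Nonempty →
    Tendsto (fun n => volume (kBoundary K (A n)) / volume (A n)) atTop (𝓝 0)

/-- The number of pairs `x, y ∈ Λ ∩ B` with `x - y = z`. These are finitely many when `Λ` is locally
finite and `B` is compact. -/
def pairCount (Λ B : Set ℝ) (z : ℝ) : ℕ :=
  {p : ℝ × ℝ | p.1 ∈ Λ ∩ B ∧ p.2 ∈ Λ ∩ B ∧ p.1 - p.2 = z}.ncard

/-- The autocorrelation of the Dirac comb `∑_{x ∈ Λ} δ_x` along `A` exists and equals `γ`: the limits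
`η z = lim_n |A_n|⁻¹ #{(x, y) ∈ (Λ ∩ A_n)² : x - y = z}` exist for all `z ∈ Λ - Λ`, and
`γ = ∑_{z ∈ Λ - Λ} η z δ_z`. -/
def IsAutocorrelation (A : ℕ → Set ℝ) (Λ : Set ℝ) (γ : Measure ℝ) : Prop :=
  ∃ η : ℝ → ℝ,
    (∀ z ∈ Λ - Λ,
      Tendsto (fun n => (pairCount Λ (A n) z : ℝ) / volume.real (A n)) atTop (𝓝 (η z))) ∧
    γ = Measure.sum fun z : ↥(Λ - Λ) => ENNReal.ofReal (η z) • Measure.dirac (z : ℝ)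

/-- The positive Radon measure `ν` on `ℝ` is the Fourier transform of the (positive) measure `γ`: for
all `φ ∈ C_c(ℝ)`, with `φ~(x) = conj (φ (-x))`, the inverse Fourier transform of `φ` lies in `L²(ν)`,
and `γ(φ * φ~) = ν(|𝓕⁻ φ|²)`. The dual group of `ℝ` is identified with `ℝ` through the characters
`x ↦ exp (2 π i k x)`. -/
structure IsFourierTransform (γ ν : Measure ℝ) : Prop where
  locallyFinite : IsLocallyFiniteMeasure ν
  memLp : ∀ φ : ℝ → ℂ, Continuous φ → HasCompactSupport φ → MemLp (𝓕⁻ φ) 2 ν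
  integral_eq : ∀ φ : ℝ → ℂ, Continuous φ → HasCompactSupport φ →
    ∫ x, (φ ⋆[ContinuousLinearMap.mul ℝ ℂ, volume] fun y => (starRingEnd ℂ) (φ (-y))) x ∂γ =
      ((∫ k, ‖𝓕⁻ φ k‖ ^ 2 ∂ν : ℝ) : ℂ)

/-- `γhat` is the diffraction measure of `Λ` with respect to `A`: the Fourier transform of the
autocorrelation of `Λ`. -/
def IsDiffraction (A : ℕ → Set ℝ) (Λ : Set ℝ) (γhat : Measure ℝ) : Prop :=
  ∃ γ : Measure ℝ, IsAutocorrelation A Λ γ ∧ IsFourierTransform γ γhat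

/-- A set with diffraction measure `γhat` has a Bragg peak at `k` if `γhat` has an atom there; its
intensity is `γhat {k}`. -/
def HasBraggPeak (γhat : Measure ℝ) (k : ℝ) : Prop :=
  0 < γhat {k}

end FibDiffraction

end

namespace FibDiffraction

open Complex

/-! For `z ∈ Λ - Λ` the lattice point above `z` has second coordinate `z⋆` of modulus at most `τ`,
and duality gives `k z + k⋆ z⋆ ∈ ℤ`. Hence `cos (2πkz) = cos (2πk⋆z⋆) ≥ 1 - 2π|k⋆|τ` on the support
of the autocorrelation `γ` (`cos_ge_of_mem_sub`).

As `γ` is positive, and `φ * φ~ ≥ 0` when `φ ≥ 0`, this bound passes to energies: modulating `φ` by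
`k` keeps at least the fraction `1 - 2π|k⋆|τ` of `γ(φ * φ~)` (`integral_fourierInv_modulate_ge`). On
the Fourier side, modulation moves the frequency `0` to `k`. Averaging `φ` over translates preserves
positivity and integral, but concentrates the transform at that frequency, so the limit of the
energies isolates the atom (`tendsto_integral_fourierInv_modulate`). -/

/-- The function `x ↦ exp (-2 π i k x) φ x`, with complex values. -/
noncomputable def modulate (k : ℝ) (φ : ℝ → ℝ) (x : ℝ) : ℂ :=
  exp (((-(2 * Real.pi * k * x) : ℝ) : ℂ) * I) * (φ x : ℂ)

/-- The mean of the translates of `φ` by `0, a, …, N a`. -/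
noncomputable def translateMean (N : ℕ) (a : ℝ) (φ : ℝ → ℝ) (x : ℝ) : ℝ :=
  ((N : ℝ) + 1)⁻¹ * ∑ j ∈ Finset.range (N + 1), φ (x - j * a)

/-- The mean of the numbers `exp (2 π i j t)` for `j = 0, …, N`. -/
noncomputable def characterMean (N : ℕ) (t : ℝ) : ℂ :=
  ((N : ℂ) + 1)⁻¹ * ∑ j ∈ Finset.range (N + 1), exp (((2 * Real.pi * t : ℝ) : ℂ) * I) ^ j

/-! ### Modulation and averaging of test functions -/

lemma continuous_modulate {φ : ℝ → ℝ} (hφ : Continuous φ) (k : ℝ) :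
    Continuous (modulate k φ) := by
  unfold modulate
  fun_prop

lemma hasCompactSupport_modulate {φ : ℝ → ℝ} (hφ : HasCompactSupport φ) (k : ℝ) :
    HasCompactSupport (modulate k φ) := by
  refine hφ.mono fun x hx => ?_
  contrapose! hx
  simp only [Function.mem_support, not_not] at hx ⊢
  simp [modulate, hx]

lemma continuous_translateMean {φ : ℝ → ℝ} (hφ : Continuous φ) (N : ℕ) (a : ℝ) :
    Continuous (translateMean N a φ) := by
  unfold translateMean
  fun_prop

lemma hasCompactSupport_translateMean {φ : ℝ → ℝ} (hφ : HasCompactSupport φ) (N : ℕ) (a : ℝ) :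
    HasCompactSupport (translateMean N a φ) := by
  have h : ∀ s : Finset ℕ, HasCompactSupport fun x => ∑ j ∈ s, φ (x - j * a) := by
    intro s
    induction s using Finset.induction_on with
    | empty => exact HasCompactSupport.zero
    | insert j s hj ih =>
      simp only [Finset.sum_insert hj]
      exact (hφ.comp_homeomorph (Homeomorph.subRight (j * a))).add ih
  exact (h _).mul_left

lemma translateMean_nonneg {φ : ℝ → ℝ} (hφ : ∀ x, 0 ≤ φ x) (N : ℕ) (a x : ℝ) :
    0 ≤ translateMean N a φ x :=
  mul_nonneg (by positivity) (Finset.sum_nonneg fun _ _ => hφ _)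

lemma fourierInv_modulate (k : ℝ) (φ : ℝ → ℝ) (v : ℝ) :
    𝓕⁻ (modulate k φ) v = ∫ x, exp (((2 * Real.pi * (x * (v - k)) : ℝ) : ℂ) * I) * (φ x : ℂ) := by
  rw [Real.fourierInv_eq']
  congr 1 with x
  rw [modulate, smul_eq_mul, ← mul_assoc, ← exp_add]
  congr 2
  simp only [RCLike.inner_apply, conj_trivial]
  push_cast
  ring

lemma fourierInv_modulate_self (k : ℝ) (φ : ℝ → ℝ) :
    𝓕⁻ (modulate k φ) k = ((∫ x, φ x : ℝ) : ℂ) := by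
  simp [fourierInv_modulate, integral_complex_ofReal]

/-- Translation by `j * a` multiplies the transform by a character, so averaging translates becomes
multiplication by a mean of characters. -/
lemma fourierInv_modulate_translateMean {φ : ℝ → ℝ} (hφ : Continuous φ)
    (hc : HasCompactSupport φ) (k : ℝ) (N : ℕ) (a v : ℝ) :
    𝓕⁻ (modulate k (translateMean N a φ)) v =
      characterMean N (a * (v - k)) * 𝓕⁻ (modulate k φ) v := by
  set e : ℝ → ℂ := fun x => exp (((2 * Real.pi * (x * (v - k)) : ℝ) : ℂ) * I) with he
  have hint : Integrable fun x => e x * (φ x : ℂ) := by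
    refine Continuous.integrable_of_hasCompactSupport (by fun_prop) ?_
    exact HasCompactSupport.mul_left (hc.comp_left (g := fun y : ℝ => (y : ℂ)) (by simp))
  have hshift : ∀ j : ℕ, (fun x => e x * (φ (x - j * a) : ℂ)) = fun x =>
      exp (((2 * Real.pi * (a * (v - k)) : ℝ) : ℂ) * I) ^ j *
        (e (x - j * a) * (φ (x - j * a) : ℂ)) := by
    intro j
    ext x
    rw [← mul_assoc, he, ← exp_nat_mul, ← exp_add]
    congr 2
    push_cast
    ring_nf
  rw [fourierInv_modulate, fourierInv_modulate, characterMean]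
  calc ∫ x, e x * (translateMean N a φ x : ℂ)
      = ∫ x, ((N : ℂ) + 1)⁻¹ * ∑ j ∈ Finset.range (N + 1), e x * (φ (x - j * a) : ℂ) := by
        congr 1 with x
        rw [translateMean, ← Finset.mul_sum]
        push_cast
        exact mul_left_comm _ _ _
    _ = _ := by
        rw [integral_const_mul, integral_finsetSum]
        · simp only [hshift, integral_const_mul]
          simp only [integral_sub_right_eq_self (fun x => e x * (φ x : ℂ)), ← Finset.sum_mul]
          exact (mul_assoc _ _ _).symm
        · intro j _
          rw [hshift]
          exact (hint.comp_sub_right (j * a)).const_mul _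

/-! ### Decay of means of characters -/

lemma norm_characterMean_le (N : ℕ) (t : ℝ) : ‖characterMean N t‖ ≤ 1 := by
  have h : ‖∑ j ∈ Finset.range (N + 1), exp (((2 * Real.pi * t : ℝ) : ℂ) * I) ^ j‖ ≤ N + 1 := by
    refine (norm_sum_le _ _).trans ?_
    simp only [norm_pow, norm_exp_ofReal_mul_I]
    simp
  have hN : ‖((N : ℂ) + 1)⁻¹‖ = ((N : ℝ) + 1)⁻¹ := by
    rw [norm_inv]
    congr 1
    exact_mod_cast Complex.norm_natCast (N + 1)
  rw [characterMean, norm_mul, hN, inv_mul_le_iff₀ (by positivity)]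
  simpa using h

lemma characterMean_zero (N : ℕ) : characterMean N 0 = 1 := by
  have : (N : ℂ) + 1 ≠ 0 := by exact_mod_cast N.succ_ne_zero
  simp [characterMean, this]

/-- Off the integers the ratio of the geometric sum is not `1`, so the sum stays bounded while the
prefactor decays. -/
lemma tendsto_characterMean {t : ℝ} (ht : ∀ n : ℤ, t ≠ n) :
    Tendsto (fun N => characterMean N t) atTop (𝓝 0) := by
  set z : ℂ := exp (((2 * Real.pi * t : ℝ) : ℂ) * I) with hz
  have hz1 : z ≠ 1 := by
    intro h
    obtain ⟨n, hn⟩ := exp_eq_one_iff.1 h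
    apply ht n
    have h2 : (2 * Real.pi * I : ℂ) ≠ 0 := two_pi_I_ne_zero
    have h3 : (t : ℂ) = n := mul_right_cancel₀ h2 (by rw [← hn]; push_cast; ring)
    exact_mod_cast h3
  have hznorm : ‖z‖ = 1 := norm_exp_ofReal_mul_I _
  refine squeeze_zero_norm (a := fun N : ℕ => (1 / ((N : ℝ) + 1)) * (2 / ‖z - 1‖)) (fun N => ?_) ?_
  · have hN : ‖((N : ℂ) + 1)⁻¹‖ = 1 / ((N : ℝ) + 1) := by
      rw [norm_inv, one_div]
      congr 1
      exact_mod_cast Complex.norm_natCast (N + 1)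
    rw [characterMean, norm_mul, hN, ← hz, geom_sum_eq hz1, norm_div]
    gcongr
    refine (norm_sub_le _ _).trans ?_
    simp only [norm_pow, hznorm]
    norm_num
  · simpa using tendsto_one_div_add_atTop_nhds_zero_nat.mul_const (2 / ‖z - 1‖)

/-- Step `1` alone fails at nonzero integers `t`; there `τ * t` is irrational, so the second factor
decays. -/
lemma tendsto_characterMean_mul_goldenRatio {t : ℝ} (ht : t ≠ 0) :
    Tendsto (fun N => characterMean N (1 * t) * characterMean N (Real.goldenRatio * t))
      atTop (𝓝 0) := by
  by_cases h : ∀ n : ℤ, t ≠ n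
  · refine squeeze_zero_norm (fun N => ?_) (by simpa using (tendsto_characterMean h).norm)
    rw [norm_mul, one_mul]
    exact mul_le_of_le_one_right (norm_nonneg _) (norm_characterMean_le _ _)
  · push Not at h
    obtain ⟨n, rfl⟩ := h
    have hn : n ≠ 0 := by exact_mod_cast ht
    have h' : ∀ m : ℤ, Real.goldenRatio * n ≠ m :=
      fun m => (Real.goldenRatio_irrational.mul_intCast hn).ne_int m
    refine squeeze_zero_norm (fun N => ?_) (by simpa using (tendsto_characterMean h').norm)
    rw [norm_mul]
    exact mul_le_of_le_one_left (norm_nonneg _) (norm_characterMean_le _ _)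

/-! ### Energies at frequencies `k` and `0` -/

/-- The function `φ ∗ φ~` of a modulated real function. -/
lemma convolution_modulate (k : ℝ) (φ : ℝ → ℝ) (x : ℝ) :
    (modulate k φ ⋆[ContinuousLinearMap.mul ℝ ℂ, volume]
      fun y => (starRingEnd ℂ) (modulate k φ (-y))) x =
      exp (((-(2 * Real.pi * k * x) : ℝ) : ℂ) * I) * ((∫ t, φ t * φ (-(x - t)) : ℝ) : ℂ) := by
  rw [convolution_def, ← integral_complex_ofReal, ← integral_const_mul]
  congr 1 with t
  simp only [modulate, ContinuousLinearMap.mul_apply', map_mul, ← exp_conj, conj_ofReal, conj_I]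
  have h : exp (((-(2 * Real.pi * k * x) : ℝ) : ℂ) * I) =
      exp (((-(2 * Real.pi * k * t) : ℝ) : ℂ) * I) *
        exp (((-(2 * Real.pi * k * -(x - t)) : ℝ) : ℂ) * -I) := by
    rw [← exp_add]
    congr 1
    push_cast
    ring
  rw [h]
  push_cast
  ring

/-- If the character of frequency `k` is `ε`-close to `1` on the support of the measure `γ`, then
modulation by `k` decreases the energy of non-negative functions by a factor at least `1 - ε`. -/
lemma integral_fourierInv_modulate_ge {γ ν : Measure ℝ} (h : IsFourierTransform γ ν)
    {k ε : ℝ} (hk : ∀ᵐ x ∂γ, 1 - ε ≤ Real.cos (2 * Real.pi * k * x))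
    {φ : ℝ → ℝ} (hφ : Continuous φ) (hc : HasCompactSupport φ) (hpos : ∀ x, 0 ≤ φ x)
    (h0 : ∫ v, ‖𝓕⁻ (modulate 0 φ) v‖ ^ 2 ∂ν ≠ 0) :
    (1 - ε) * ∫ v, ‖𝓕⁻ (modulate 0 φ) v‖ ^ 2 ∂ν ≤ ∫ v, ‖𝓕⁻ (modulate k φ) v‖ ^ 2 ∂ν := by
  set G : ℝ → ℝ := fun x => ∫ t, φ t * φ (-(x - t)) with hG
  have hG0 : ∀ x, 0 ≤ G x := fun x => integral_nonneg fun t => mul_nonneg (hpos _) (hpos _)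
  have e0 := h.integral_eq _ (continuous_modulate hφ 0) (hasCompactSupport_modulate hc 0)
  have ek := h.integral_eq _ (continuous_modulate hφ k) (hasCompactSupport_modulate hc k)
  simp only [convolution_modulate] at e0 ek
  simp only [mul_zero, zero_mul, neg_zero, ofReal_zero, exp_zero, one_mul] at e0
  rw [integral_complex_ofReal, ofReal_inj] at e0
  -- A non-integrable function has Bochner integral `0`, which the hypothesis `h0` excludes.
  have hint : Integrable G γ := by
    by_contra hn
    exact h0 (by rw [← e0]; exact integral_undef hn)
  have hmeas : Continuous fun x : ℝ => exp (((-(2 * Real.pi * k * x) : ℝ) : ℂ) * I) := by fun_prop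
  have hint' : Integrable
      (fun x => exp (((-(2 * Real.pi * k * x) : ℝ) : ℂ) * I) * (G x : ℂ)) γ :=
    hint.ofReal.bdd_mul hmeas.aestronglyMeasurable (c := 1)
      (.of_forall fun x => (norm_exp_ofReal_mul_I _).le)
  have hre : ∀ x, (exp (((-(2 * Real.pi * k * x) : ℝ) : ℂ) * I) * (G x : ℂ)).re =
      Real.cos (2 * Real.pi * k * x) * G x := by
    intro x
    rw [re_mul_ofReal, exp_ofReal_mul_I_re, Real.cos_neg]
  have hek : ∫ v, ‖𝓕⁻ (modulate k φ) v‖ ^ 2 ∂ν =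
      ∫ x, Real.cos (2 * Real.pi * k * x) * G x ∂γ := by
    rw [← ofReal_re (∫ v, ‖𝓕⁻ (modulate k φ) v‖ ^ 2 ∂ν), ← ek]
    simp only [← hre]
    exact (integral_re hint').symm
  rw [hek, ← e0, ← integral_const_mul]
  refine integral_mono_ae (hint.const_mul _) ?_ ?_
  · simp only [← hre]
    exact hint'.re
  · filter_upwards [hk] with x hx
    exact mul_le_mul_of_nonneg_right hx (hG0 x)

lemma integrable_fourierInv_modulate {γ ν : Measure ℝ} (h : IsFourierTransform γ ν) (k : ℝ)
    {φ : ℝ → ℝ} (hφ : Continuous φ) (hc : HasCompactSupport φ) :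
    Integrable (fun v => ‖𝓕⁻ (modulate k φ) v‖ ^ 2) ν :=
  (h.memLp _ (continuous_modulate hφ k) (hasCompactSupport_modulate hc k)).integrable_norm_pow
    two_ne_zero

lemma integral_sq_mul_measureReal_le {γ ν : Measure ℝ} (h : IsFourierTransform γ ν) (k : ℝ)
    {φ : ℝ → ℝ} (hφ : Continuous φ) (hc : HasCompactSupport φ) :
    (∫ x, φ x) ^ 2 * ν.real {k} ≤ ∫ v, ‖𝓕⁻ (modulate k φ) v‖ ^ 2 ∂ν := by
  have := setIntegral_le_integral (s := {k}) (integrable_fourierInv_modulate h k hφ hc)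
    (.of_forall fun v => by positivity)
  rw [integral_singleton, fourierInv_modulate_self, norm_real, Real.norm_eq_abs, sq_abs,
    smul_eq_mul, mul_comm] at this
  exact this

/-! ### Isolating the atoms -/

/-- The atom of a Fourier transform at `k` as a limit of integrals of modulated test functions. -/
lemma tendsto_integral_fourierInv_modulate {γ ν : Measure ℝ} (h : IsFourierTransform γ ν) (k : ℝ)
    {φ : ℝ → ℝ} (hφ : Continuous φ) (hc : HasCompactSupport φ) :
    Tendsto (fun N => ∫ v, ‖𝓕⁻ (modulate k (translateMean N 1
      (translateMean N Real.goldenRatio φ))) v‖ ^ 2 ∂ν) atTop (𝓝 ((∫ x, φ x) ^ 2 * ν.real {k})) := by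
  have hF : ∀ N v, 𝓕⁻ (modulate k (translateMean N 1 (translateMean N Real.goldenRatio φ))) v =
      characterMean N (1 * (v - k)) * characterMean N (Real.goldenRatio * (v - k)) *
        𝓕⁻ (modulate k φ) v := by
    intro N v
    rw [fourierInv_modulate_translateMean (continuous_translateMean hφ _ _)
      (hasCompactSupport_translateMean hc _ _), fourierInv_modulate_translateMean hφ hc, mul_assoc]
  have hlim : (∫ x, φ x) ^ 2 * ν.real {k} =
      ∫ v, ({k} : Set ℝ).indicator (fun _ => (∫ x, φ x) ^ 2) v ∂ν := by
    rw [integral_indicator_const _ (measurableSet_singleton k), smul_eq_mul, mul_comm]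
  rw [hlim]
  -- Character means have modulus at most `1`, so the unaveraged energy density dominates for every
  -- `N`.
  refine tendsto_integral_of_dominated_convergence (fun v => ‖𝓕⁻ (modulate k φ) v‖ ^ 2)
    (fun N => ?_) (integrable_fourierInv_modulate h k hφ hc) (fun N => .of_forall fun v => ?_)
    (.of_forall fun v => ?_)
  · exact (integrable_fourierInv_modulate h k
      (continuous_translateMean (continuous_translateMean hφ _ _) _ _)
      (hasCompactSupport_translateMean (hasCompactSupport_translateMean hc _ _) _ _)).1
  · rw [Real.norm_of_nonneg (by positivity), hF, norm_mul, norm_mul]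
    gcongr
    exact mul_le_of_le_one_left (norm_nonneg _) (mul_le_one₀ (norm_characterMean_le _ _)
      (norm_nonneg _) (norm_characterMean_le _ _))
  · simp only [hF]
    by_cases hv : v = k
    · subst hv
      simp [characterMean_zero, fourierInv_modulate_self]
    · rw [Set.indicator_of_notMem (by simpa using hv)]
      simpa using (((tendsto_characterMean_mul_goldenRatio (sub_ne_zero.2 hv)).mul_const
        (𝓕⁻ (modulate k φ) v)).norm.pow 2)

lemma integral_translateMean {φ : ℝ → ℝ} (hφ : Continuous φ) (hc : HasCompactSupport φ)
    (N : ℕ) (a : ℝ) : ∫ x, translateMean N a φ x = ∫ x, φ x := by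
  have h := fourierInv_modulate_translateMean hφ hc 0 N a 0
  rw [fourierInv_modulate_self, fourierInv_modulate_self, sub_self, mul_zero, characterMean_zero,
    one_mul] at h
  exact_mod_cast h

/-- If the character of frequency `k` is `ε`-close to `1` on the support of `γ`, then the atoms of
the Fourier transform of `γ` at `k` and at `0` are related by a factor at least `1 - ε`. -/
lemma measureReal_singleton_ge {γ ν : Measure ℝ} (h : IsFourierTransform γ ν)
    {k ε : ℝ} (hε : ε ≤ 1) (hk : ∀ᵐ x ∂γ, 1 - ε ≤ Real.cos (2 * Real.pi * k * x))
    (h0 : 0 < ν.real {0}) : (1 - ε) * ν.real {0} ≤ ν.real {k} := by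
  let φ : ContDiffBump (0 : ℝ) := ⟨1, 2, one_pos, one_lt_two⟩
  have hφ : Continuous φ := φ.continuous
  have hc : HasCompactSupport φ := φ.hasCompactSupport
  have hpos : 0 < (∫ x, φ x) ^ 2 := by
    have := φ.integral_pos (μ := volume)
    positivity
  refine le_of_mul_le_mul_left ?_ hpos
  -- The limit is needed only at `k`: at `0` the atom bounds the energy from below for each `N`,
  -- since averaging keeps the integral.
  refine ge_of_tendsto' (tendsto_integral_fourierInv_modulate h k hφ hc) fun N => ?_
  set g := translateMean N 1 (translateMean N Real.goldenRatio φ)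
  have hg : Continuous g := continuous_translateMean (continuous_translateMean hφ _ _) _ _
  have hgc : HasCompactSupport g :=
    hasCompactSupport_translateMean (hasCompactSupport_translateMean hc _ _) _ _
  have hg0 : ∀ x, 0 ≤ g x :=
    translateMean_nonneg (translateMean_nonneg (fun _ => φ.nonneg) _ _) _ _
  have hgi : ∫ x, g x = ∫ x, φ x := by
    rw [integral_translateMean (continuous_translateMean hφ _ _)
      (hasCompactSupport_translateMean hc _ _), integral_translateMean hφ hc]
  have hle := integral_sq_mul_measureReal_le h 0 hg hgc
  rw [hgi] at hle
  have hne := ((mul_pos hpos h0).trans_le hle).ne'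
  calc (∫ x, φ x) ^ 2 * ((1 - ε) * ν.real {0}) = (1 - ε) * ((∫ x, φ x) ^ 2 * ν.real {0}) := by ring
    _ ≤ (1 - ε) * ∫ v, ‖𝓕⁻ (modulate 0 g) v‖ ^ 2 ∂ν :=
        mul_le_mul_of_nonneg_left hle (sub_nonneg.2 hε)
    _ ≤ _ := integral_fourierInv_modulate_ge h hk hg hgc hg0 hne

/-! ### Arithmetic of the Fibonacci lattice -/

lemma cos_ge_of_mem_sub {z : ℝ} (hz : z ∈ Fib - Fib) {k l : ℝ}
    (hkl : (k, l) ∈ dualLattice fibLattice) :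
    1 - 2 * Real.pi * |l| * Real.goldenRatio ≤ Real.cos (2 * Real.pi * k * z) := by
  obtain ⟨x, ⟨x', hx', a, b, hab⟩, y, ⟨y', hy', c, d, hcd⟩, rfl⟩ := hz
  rw [Prod.mk.injEq] at hab hcd
  have hmem : (x - y, x' - y') ∈ fibLattice := by
    refine ⟨a - c, b - d, Prod.ext ?_ ?_⟩
    · simp only [hab.1, hcd.1]; push_cast; ring
    · simp only [hab.2, hcd.2]; push_cast; ring
  obtain ⟨n, hn⟩ := exp_eq_one_iff.1 (hkl _ hmem)
  have hn' : (x - y) * k + (x' - y') * l = n := by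
    have h3 := mul_right_cancel₀ two_pi_I_ne_zero ((mul_comm _ _).trans hn)
    exact_mod_cast h3
  -- The window `[-1, τ - 1)` has length `τ`.
  have habs : |x' - y'| ≤ Real.goldenRatio := by
    rw [abs_le]
    constructor <;> linarith [hx'.1, hx'.2, hy'.1, hy'.2]
  have hcos : Real.cos (2 * Real.pi * k * (x - y)) = Real.cos (2 * Real.pi * l * (x' - y')) := by
    rw [← Real.cos_int_mul_two_pi_sub _ n]
    congr 1
    rw [← hn']
    ring
  -- The cosine is 1-Lipschitz and equals `1` at `0`.
  have hlip : 1 - |2 * Real.pi * l * (x' - y')| ≤ Real.cos (2 * Real.pi * l * (x' - y')) := by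
    have h := (le_abs_self _).trans (Real.abs_cos_sub_cos_le 0 (2 * Real.pi * l * (x' - y')))
    rw [Real.cos_zero, zero_sub, abs_neg] at h
    linarith
  have h2 : |2 * Real.pi * l * (x' - y')| = 2 * Real.pi * |l| * |x' - y'| := by
    rw [abs_mul, abs_mul, abs_of_pos Real.two_pi_pos]
  have h3 : 2 * Real.pi * |l| * |x' - y'| ≤ 2 * Real.pi * |l| * Real.goldenRatio := by gcongr
  rw [hcos]
  linarith

lemma ae_mem_of_isAutocorrelation {A : ℕ → Set ℝ} {Λ : Set ℝ} {γ : Measure ℝ}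
    (h : IsAutocorrelation A Λ γ) {s : Set ℝ} (hs : MeasurableSet s) (hΛ : Λ - Λ ⊆ s) :
    ∀ᵐ x ∂γ, x ∈ s := by
  obtain ⟨η, -, rfl⟩ := h
  refine (Measure.ae_sum_iff' hs).2 fun z => Measure.ae_smul_measure ?_ _
  rw [ae_dirac_iff hs]
  exact hΛ z.2

end FibDiffraction

theorem mainTheorem7 (Λ : Set ℝ) (hΛ : Λ ⊆ FibDiffraction.Fib)
    (A : ℕ → Set ℝ) (hA : FibDiffraction.IsVanHove A)
    (γhat : Measure ℝ) (hγ : FibDiffraction.IsDiffraction A Λ γhat)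
    (h0 : FibDiffraction.HasBraggPeak γhat 0)
    (k : ℝ)
    (hk : k ∈ FibDiffraction.dualModelSet
      (Set.Ioo (-(1 / (2 * Real.pi * Real.goldenRatio))) (1 / (2 * Real.pi * Real.goldenRatio)))) :
    FibDiffraction.HasBraggPeak γhat k ∧
      γhat.real {k} ≥
        (1 - 2 * Real.pi * |FibDiffraction.dualStar k| * Real.goldenRatio) * γhat.real {0} ∧
      (1 - 2 * Real.pi * |FibDiffraction.dualStar k| * Real.goldenRatio) * γhat.real {0} > 0 := by
  obtain ⟨γ, hauto, hfour⟩ := hγ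
  obtain ⟨m, n, hkeq, hl⟩ := (FibDiffraction.mem_dualModelSet_iff _ _).1 hk
  have hmem : (k, FibDiffraction.dualStar k) ∈
      FibDiffraction.dualLattice FibDiffraction.fibLattice :=
    (FibDiffraction.mem_dualLattice_fib_iff _).2 ⟨m, n, by rw [hkeq, FibDiffraction.dualStar_eq]⟩
  rw [← FibDiffraction.dualStar_eq, ← hkeq, Set.mem_Ioo, ← abs_lt, lt_div_iff₀
    (mul_pos Real.two_pi_pos Real.goldenRatio_pos)] at hl
  set l := FibDiffraction.dualStar k
  have hε : 0 < 1 - 2 * Real.pi * |l| * Real.goldenRatio := by linarith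
  have := hfour.locallyFinite
  -- Local finiteness makes the atom finite, so its positivity survives `toReal`.
  have h0' : 0 < γhat.real {0} :=
    ENNReal.toReal_pos h0.ne' isCompact_singleton.measure_lt_top.ne
  have hae : ∀ᵐ x ∂γ, 1 - 2 * Real.pi * |l| * Real.goldenRatio ≤ Real.cos (2 * Real.pi * k * x) :=
    FibDiffraction.ae_mem_of_isAutocorrelation hauto
      (s := {x | 1 - 2 * Real.pi * |l| * Real.goldenRatio ≤ Real.cos (2 * Real.pi * k * x)})
      (measurableSet_le measurable_const (by fun_prop))
      fun z hz => FibDiffraction.cos_ge_of_mem_sub (Set.sub_subset_sub hΛ hΛ hz) hmem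
  have hge := FibDiffraction.measureReal_singleton_ge hfour (by linarith) hae h0'
  have hpos := mul_pos hε h0'
  exact ⟨(ENNReal.toReal_pos_iff.1 (hpos.trans_le hge)).1, hge, hpos⟩
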